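/- Let $\mu$ be a measurable function on $(0,\infty)$ with $\mu(t)>0$ for Lebesgue-almost every $t>0$, let $M(dt)=\mu(t)\,dt$ be the measure on $(0,\infty)$ with density $\mu$, write $M(a,b)=\int_a^b\mu(t)\,dt$, and assume $M(0,t)<\infty$ for every $t<\infty$. Let $\ell>0$. Let $\mathcal N$ be an inhomogeneous Poisson process on $(0,\infty)$ with rate function $\mu$ (that is, with intensity measure $M$), and let $0<T_1<T_2<\cdots$ be its epochs, with $T_0=0$ and with $T_{n+1}=\infty$ if $\mathcal N$ has only $n$ points. Let $$D=\min\{T_n:\ n\ge 0,\ T_n<\infty,\ T_{n+1}-T_n\ge \ell\}$$ be the first epoch ($T_0=0$ included) that is followed by a gap of length at least $\ell$, where $D=\infty$ if there is no such epoch. If $M(0,\infty)<\infty$, then $D<\infty$ almost surely. Otherwise, that is, if $M(0,\infty)=\infty$, let $$I=\int_0^\infty e^{-M(t,t+\ell)}\,\mu(t)\,dt\in[0,\infty].$$ Then $D<\infty$ almost surely if $I=\infty$, and $\mathbb P(D=\infty)>0$ if $I<\infty$. -/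

import Mathlib

open MeasureTheory ProbabilityTheory Set
open scoped ENNReal NNReal

noncomputable section

namespace GapProblem

/-- The intensity measure `M(dt) = μ(t) dt` on `(0, ∞)`, as a measure on `ℝ` that does not
charge `(-∞, 0]`. -/
def intensity (μ : ℝ → ℝ) : Measure ℝ :=
  (volume.restrict (Ioi (0 : ℝ))).withDensity (fun t => ENNReal.ofReal (μ t))

/-- The Poisson distribution with mean `m ∈ [0, ∞]`, as a measure on `ℕ ∪ {∞}`; for `m = ∞` it
is the point mass at `∞`. -/
def extPoisson (m : ℝ≥0∞) : Measure ℕ∞ :=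
  if m = ∞ then Measure.dirac ⊤
  else (poissonMeasure m.toNNReal).map (fun n : ℕ => (n : ℕ∞))

/-- The random subset `N` of `(0, ∞)` is a Poisson process with intensity measure `M`: the number
of its points in a Borel set `B` is a Poisson random variable with mean `M B`, and the numbers of
points in finitely many pairwise disjoint Borel sets are independent. -/
structure IsPoissonProcess {Ω : Type*} [MeasurableSpace Ω] (N : Ω → Set ℝ) (M : Measure ℝ)
    (P : Measure Ω) : Prop where
  subset_Ioi : ∀ ω, N ω ⊆ Ioi 0
  measurable_count : ∀ B : Set ℝ, MeasurableSet B → Measurable (fun ω => (N ω ∩ B).encard)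
  map_count : ∀ B : Set ℝ, MeasurableSet B →
    P.map (fun ω => (N ω ∩ B).encard) = extPoisson (M B)
  indep_count : ∀ (k : ℕ) (B : Fin k → Set ℝ), (∀ i, MeasurableSet (B i)) →
    Pairwise (fun i j => Disjoint (B i) (B j)) →
    iIndepFun (fun i ω => (N ω ∩ B i).encard) P

/-- The epochs `0 = T₀ < T₁ < T₂ < ⋯` of a point configuration `S` in `(0, ∞)`: `T₀ = 0` and
`Tₙ₊₁` is the first point of `S` after `Tₙ`, with `Tₙ₊₁ = ∞` if there is none. -/
def epoch (S : Set ℝ) : ℕ → ℝ≥0∞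
  | 0 => 0
  | n + 1 => sInf (ENNReal.ofReal '' {s ∈ S | epoch S n < ENNReal.ofReal s})

/-- `D = min {Tₙ : Tₙ < ∞, Tₙ₊₁ - Tₙ ≥ ℓ}`, the first epoch that is followed by a gap of length at
least `ℓ`; `D = ∞` if there is none. -/
def firstGap (ℓ : ℝ) (S : Set ℝ) : ℝ≥0∞ :=
  sInf {x | ∃ n : ℕ, x = epoch S n ∧ epoch S n < ∞ ∧
    ENNReal.ofReal ℓ ≤ epoch S (n + 1) - epoch S n}

/-- `I = ∫₀^∞ exp (-M(t, t + ℓ)) μ(t) dt`, with values in `[0, ∞]`. -/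
def gapIntegral (μ : ℝ → ℝ) (ℓ : ℝ) : ℝ≥0∞ :=
  ∫⁻ t in Ioi (0 : ℝ),
    ENNReal.ofReal (Real.exp (-(intensity μ (Ioo t (t + ℓ))).toReal) * μ t)

end GapProblem

end

namespace GapProblem

/-! ### Deterministic facts about gaps in locally finite configurations. -/

section Epochs

variable {S : Set ℝ}

/-! For a locally finite configuration, `D < ∞` exactly when `0` or some point `s` is followed by an
empty window `(s, s + ℓ)`. If `M` is finite, the last point has this property.

If `M` is infinite, let `F` be the cumulative function and cut `(a, ∞)` into cells on each of which
`F(t) + F(t + ℓ)` grows by one (`exists_partition`). The void probability `exp (-M(x, x + ℓ))` then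
varies only by a bounded factor on a cell, so its integral over the cell is comparable, up to a
factor `e²`, to the probability that the cell is hit and a window after it is empty. Thus `I`
behaves like a sum of probabilities of such events.

When `I = ∞`, these events are pairwise negatively correlated, because an empty window after one
cell only makes later cells harder to hit. Chebyshev's inequality then shows that one of them occurs
almost surely.

When `I < ∞`, put `h = ℓ / 2`. The tail beyond a late `m h` produces a gap with probability below
`1/2`, and `m` can be chosen so that the interval `(m h, (m + 1) h)` is empty with probability at
most `1/2`. Both kinds of event are independent of the event `A` that all earlier intervals of
length `h` are hit, which has positive probability since `μ > 0`. A union bound leaves a part of `A`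
of positive probability on which there is no gap. -/

theorem epoch_succ_eq_ofReal {n : ℕ} {s : ℝ} (hs : s ∈ S) (hlt : epoch S n < ENNReal.ofReal s)
    (hmin : ∀ x ∈ S, epoch S n < ENNReal.ofReal x → s ≤ x) :
    epoch S (n + 1) = ENNReal.ofReal s := by
  refine IsLeast.csInf_eq ⟨⟨s, ⟨hs, hlt⟩, rfl⟩, ?_⟩
  rintro _ ⟨x, ⟨hx, hxlt⟩, rfl⟩
  exact ENNReal.ofReal_le_ofReal (hmin x hx hxlt)

theorem epoch_eq_top_or_mem (hfin : ∀ b : ℝ, (S ∩ Iic b).Finite) (n : ℕ) :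
    epoch S n = ∞ ∨ ∃ s ∈ insert 0 S, epoch S n = ENNReal.ofReal s := by
  cases n with
  | zero => exact Or.inr ⟨0, by simp, by simp [epoch]⟩
  | succ n =>
    by_cases hne : ∃ s ∈ S, epoch S n < ENNReal.ofReal s
    · obtain ⟨x, hx, hxlt⟩ := hne
      obtain ⟨s, ⟨⟨hs, hsx⟩, hslt⟩, hsmin⟩ :=
        Set.exists_min_image (S ∩ Iic x ∩ {y | epoch S n < ENNReal.ofReal y}) id
          ((hfin x).subset inter_subset_left) ⟨x, ⟨hx, self_mem_Iic⟩, hxlt⟩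
      refine Or.inr ⟨s, by simp [hs], epoch_succ_eq_ofReal hs hslt fun y hy hylt => ?_⟩
      rcases le_total y x with h | h
      · exact hsmin y ⟨⟨hy, h⟩, hylt⟩
      · exact le_trans hsx h
    · left
      push Not at hne
      rw [epoch, sInf_eq_top]
      rintro _ ⟨x, ⟨hx, hxlt⟩, rfl⟩
      exact absurd hxlt (not_lt.2 (hne x hx))

/-- Induction on the number of points up to `s`: the predecessor `p` of `s` is an epoch, and `s` is
the next one. -/
theorem exists_epoch_eq (hpos : S ⊆ Ioi 0) (hfin : ∀ b : ℝ, (S ∩ Iic b).Finite) {s : ℝ}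
    (hs : s ∈ S) : ∃ n, epoch S n = ENNReal.ofReal s := by
  induction hm : (S ∩ Iic s).ncard using Nat.strong_induction_on generalizing s with
  | _ m ih =>
    have hs0 : 0 < s := hpos hs
    rcases (S ∩ Iio s).eq_empty_or_nonempty with he | hne
    · refine ⟨1, epoch_succ_eq_ofReal hs (by simpa [epoch] using hs0) fun x hx _ => ?_⟩
      by_contra h
      exact (he ▸ (⟨hx, not_le.1 h⟩ : x ∈ S ∩ Iio s) : x ∈ (∅ : Set ℝ))
    · obtain ⟨p, ⟨hp, hps⟩, hpmax⟩ := Set.exists_max_image (S ∩ Iio s) id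
        ((hfin s).subset (inter_subset_inter_right _ Iio_subset_Iic_self)) hne
      have hlt : (S ∩ Iic p).ncard < m := by
        rw [← hm]
        refine Set.ncard_lt_ncard ⟨inter_subset_inter_right _ (Iic_subset_Iic.2 (le_of_lt hps)),
          fun h => ?_⟩ (hfin s)
        exact absurd (mem_Iic.1 (h ⟨hs, self_mem_Iic⟩).2) (not_le.2 hps)
      obtain ⟨n, hn⟩ := ih _ hlt hp rfl
      refine ⟨n + 1, epoch_succ_eq_ofReal hs ?_ fun x hx hxlt => ?_⟩
      · rw [hn]
        exact (ENNReal.ofReal_lt_ofReal_iff hs0).2 hps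
      · by_contra h
        rw [hn, ENNReal.ofReal_lt_ofReal_iff (hpos hx)] at hxlt
        exact absurd (hpmax x ⟨hx, not_le.1 h⟩) (not_le.2 hxlt)

/-- A locally finite configuration with an empty window of length `ℓ` after the origin or after one
of its points has a first gap. -/
theorem firstGap_lt_top (hpos : S ⊆ Ioi 0) (hfin : ∀ b : ℝ, (S ∩ Iic b).Finite) {ℓ s : ℝ}
    (hs : s ∈ insert 0 S) (hgap : S ∩ Ioo s (s + ℓ) = ∅) : firstGap ℓ S < ∞ := by
  have hs0 : 0 ≤ s := by
    rcases hs with rfl | hs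
    · exact le_rfl
    · exact (hpos hs).le
  obtain ⟨n, hn⟩ : ∃ n, epoch S n = ENNReal.ofReal s := by
    rcases hs with rfl | hs
    · exact ⟨0, by simp [epoch]⟩
    · exact exists_epoch_eq hpos hfin hs
  have hnext : ENNReal.ofReal (s + ℓ) ≤ epoch S (n + 1) := by
    refine le_sInf ?_
    rintro _ ⟨x, ⟨hx, hxlt⟩, rfl⟩
    rw [hn, ENNReal.ofReal_lt_ofReal_iff (hpos hx)] at hxlt
    refine ENNReal.ofReal_le_ofReal (not_lt.1 fun h => ?_)
    exact (hgap ▸ (⟨hx, hxlt, h⟩ : x ∈ S ∩ Ioo s (s + ℓ)) : x ∈ (∅ : Set ℝ))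
  have hlt : epoch S n < ∞ := hn ▸ ENNReal.ofReal_lt_top
  refine lt_of_le_of_lt (sInf_le ⟨n, rfl, hlt, ?_⟩) hlt
  rw [hn]
  refine le_trans ?_ (tsub_le_tsub_right hnext _)
  rw [← ENNReal.ofReal_sub _ hs0]
  simp

/-- A locally finite configuration with a point in the window of length `ℓ` after the origin and
after each of its points has no gap. -/
theorem firstGap_eq_top (hpos : S ⊆ Ioi 0) (hfin : ∀ b : ℝ, (S ∩ Iic b).Finite) {ℓ : ℝ}
    (hℓ : 0 < ℓ) (hgap : ∀ s ∈ insert 0 S, (S ∩ Ioo s (s + ℓ)).Nonempty) :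
    firstGap ℓ S = ∞ := by
  refine sInf_eq_top.2 ?_
  rintro _ ⟨n, rfl, hlt, hle⟩
  exfalso
  rcases epoch_eq_top_or_mem hfin n with h | ⟨s, hs, hn⟩
  · exact hlt.ne h
  · have hs0 : 0 ≤ s := by
      rcases hs with rfl | hs
      · exact le_rfl
      · exact (hpos hs).le
    obtain ⟨x, hx, hsx, hxl⟩ := hgap s hs
    have hnext : epoch S (n + 1) ≤ ENNReal.ofReal x :=
      sInf_le ⟨x, ⟨hx, by rw [hn]; exact (ENNReal.ofReal_lt_ofReal_iff (hpos hx)).2 hsx⟩, rfl⟩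
    have := hle.trans (tsub_le_tsub_right hnext _)
    rw [hn, ← ENNReal.ofReal_sub _ hs0] at this
    exact absurd ((ENNReal.ofReal_lt_ofReal_iff hℓ).2 (by linarith)) (not_lt.2 this)

/-- The last point in `(a, b]` of a configuration with no point in `(b, b + ℓ]` is followed by an
empty window of length `ℓ`. -/
theorem exists_empty_window (hfin : ∀ b : ℝ, (S ∩ Iic b).Finite) {a b ℓ : ℝ}
    (hne : (S ∩ Ioc a b).Nonempty) (he : S ∩ Ioc b (b + ℓ) = ∅) :
    ∃ s ∈ S, S ∩ Ioo s (s + ℓ) = ∅ := by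
  obtain ⟨s, ⟨hs, has, hsb⟩, hmax⟩ := Set.exists_max_image (S ∩ Ioc a b) id
    ((hfin b).subset (inter_subset_inter_right _ fun x hx => hx.2)) hne
  refine ⟨s, hs, eq_empty_of_forall_notMem ?_⟩
  rintro x ⟨hx, hsx, hxl⟩
  rcases le_or_gt x b with h | h
  · exact absurd (hmax x ⟨hx, has.trans hsx, h⟩) (not_le.2 hsx)
  · exact (he ▸ (⟨hx, h, by linarith⟩ : x ∈ S ∩ Ioc b (b + ℓ)) : x ∈ (∅ : Set ℝ))

end Epochs

end GapProblem

namespace GapProblem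

/-! ### A Borel–Cantelli lemma by the second moment method. -/

section SecondMoment

variable {Ω : Type*} [MeasurableSpace Ω] {P : Measure Ω} [IsProbabilityMeasure P]

/-- Chebyshev's inequality for the number `X` of events among the first `n` that occur: its mean is
`m`, negative correlation bounds its variance by `m`, and `(X - m)² = m²` where no event occurs. -/
theorem sq_mul_measureReal_iInter_compl_le {E : ℕ → Set Ω} (hE : ∀ k, MeasurableSet (E k))
    (hneg : ∀ j k, j < k → P.real (E j ∩ E k) ≤ P.real (E j) * P.real (E k)) (n : ℕ) :
    (∑ k ∈ Finset.range n, P.real (E k)) ^ 2 * P.real (⋂ k, (E k)ᶜ) ≤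
      ∑ k ∈ Finset.range n, P.real (E k) := by
  set m := ∑ k ∈ Finset.range n, P.real (E k) with hm
  let X : Ω → ℝ := fun ω => ∑ k ∈ Finset.range n, (E k).indicator 1 ω
  have hind : ∀ A : Set Ω, MeasurableSet A → Integrable (A.indicator (1 : Ω → ℝ)) P := fun A hA =>
    (integrable_const (1 : ℝ)).indicator hA
  have hXi : Integrable X P := integrable_finsetSum _ fun k _ => hind _ (hE k)
  have hX : ∫ ω, X ω ∂P = m := by
    simp only [X]
    rw [integral_finsetSum _ fun k _ => hind _ (hE k)]
    exact Finset.sum_congr rfl fun k _ => integral_indicator_one (hE k)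
  have hXsq : ∀ ω, X ω ^ 2 =
      ∑ j ∈ Finset.range n, ∑ k ∈ Finset.range n, (E j ∩ E k).indicator (1 : Ω → ℝ) ω := by
    intro ω
    simp only [X, sq, Finset.sum_mul_sum, Set.inter_indicator_one, Pi.mul_apply]
  have hXsqi : Integrable (fun ω => X ω ^ 2) P := by
    simp only [hXsq]
    exact integrable_finsetSum _ fun j _ => integrable_finsetSum _ fun k _ =>
      hind _ ((hE j).inter (hE k))
  have hX2 : ∫ ω, X ω ^ 2 ∂P ≤ m + m ^ 2 := by
    simp only [hXsq]
    rw [integral_finsetSum _ fun j _ => integrable_finsetSum _ fun k _ =>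
      hind _ ((hE j).inter (hE k))]
    have : ∀ j ∈ Finset.range n, ∫ ω, ∑ k ∈ Finset.range n,
        (E j ∩ E k).indicator (1 : Ω → ℝ) ω ∂P ≤ P.real (E j) + P.real (E j) * m := by
      intro j hj
      rw [integral_finsetSum _ fun k _ => hind _ ((hE j).inter (hE k)), hm, Finset.mul_sum]
      -- The diagonal term is written as a sum over `k` so that the bound can be checked term by
      -- term.
      have hj' : P.real (E j) = ∑ k ∈ Finset.range n, if k = j then P.real (E j) else 0 := by
        rw [Finset.sum_ite_eq' (Finset.range n) j, if_pos hj]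
      have hsplit : P.real (E j) + ∑ k ∈ Finset.range n, P.real (E j) * P.real (E k) =
          ∑ k ∈ Finset.range n,
            ((if k = j then P.real (E j) else 0) + P.real (E j) * P.real (E k)) := by
        rw [Finset.sum_add_distrib, ← hj']
      rw [hsplit]
      refine Finset.sum_le_sum fun k _ => ?_
      rw [integral_indicator_one ((hE j).inter (hE k))]
      have hnn : 0 ≤ P.real (E j) * P.real (E k) := by positivity
      rcases lt_trichotomy j k with h | h | h
      · simpa [h.ne'] using hneg j k h
      · subst h
        simpa using hnn
      · rw [inter_comm, mul_comm]
        simpa [h.ne] using hneg k j h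
    refine (Finset.sum_le_sum this).trans_eq ?_
    rw [Finset.sum_add_distrib, ← Finset.sum_mul]
    ring
  have hexp : ∀ ω, (X ω - m) ^ 2 = X ω ^ 2 - 2 * m * X ω + m ^ 2 := fun ω => by ring
  have hdiff : Integrable (fun ω => X ω ^ 2 - 2 * m * X ω) P := hXsqi.sub (hXi.const_mul _)
  have hvar : ∫ ω, (X ω - m) ^ 2 ∂P ≤ m := by
    simp only [hexp]
    rw [integral_add hdiff (integrable_const _),
      integral_sub hXsqi (hXi.const_mul _), integral_const_mul, hX]
    simp
    linarith
  refine le_trans ?_ hvar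
  have hA : MeasurableSet (⋂ k, (E k)ᶜ) := MeasurableSet.iInter fun k => (hE k).compl
  rw [← integral_indicator_one hA, ← integral_const_mul]
  have hint : Integrable (fun ω => (X ω - m) ^ 2) P := by
    simp only [hexp]
    exact hdiff.add (integrable_const _)
  refine integral_mono ((hind _ hA).const_mul _) hint fun ω => ?_
  by_cases hω : ω ∈ ⋂ k, (E k)ᶜ
  · have h0 : X ω = 0 := Finset.sum_eq_zero fun k _ =>
      indicator_of_notMem (mem_iInter.1 hω k) _
    simp [hω, h0]
  · rw [indicator_of_notMem hω]
    simpa using sq_nonneg (X ω - m)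

/-- A second Borel–Cantelli lemma for pairwise negatively correlated events. -/
theorem ae_exists_mem_of_tsum_eq_top {E : ℕ → Set Ω} (hE : ∀ k, MeasurableSet (E k))
    (hneg : ∀ j k, j < k → P.real (E j ∩ E k) ≤ P.real (E j) * P.real (E k))
    (hsum : ∑' k, P (E k) = ∞) : ∀ᵐ ω ∂P, ∃ k, ω ∈ E k := by
  have htend : Filter.Tendsto (fun n => ∑ k ∈ Finset.range n, P.real (E k)) Filter.atTop
      Filter.atTop := by
    rw [← not_summable_iff_tendsto_nat_atTop_of_nonneg fun k => measureReal_nonneg]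
    intro h
    refine h.tsum_ofReal_ne_top ?_
    rw [← hsum]
    exact tsum_congr fun k => ENNReal.ofReal_toReal (measure_ne_top P _)
  have hzero : P.real (⋂ k, (E k)ᶜ) = 0 := by
    refine le_antisymm (not_lt.1 fun hpos => ?_) measureReal_nonneg
    obtain ⟨n, hn⟩ := (htend.eventually_gt_atTop ((P.real (⋂ k, (E k)ᶜ))⁻¹)).exists
    have h := sq_mul_measureReal_iInter_compl_le hE hneg n
    have hm : 0 < ∑ k ∈ Finset.range n, P.real (E k) := (inv_pos.2 hpos).trans hn
    rw [sq, mul_assoc, mul_le_iff_le_one_right hm] at h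
    have := mul_lt_mul_of_pos_right hn hpos
    rw [inv_mul_cancel₀ hpos.ne'] at this
    linarith
  rw [ae_iff]
  rw [measureReal_eq_zero_iff] at hzero
  convert hzero using 2
  ext ω
  simp

end SecondMoment

/-! ### Void probabilities and independence for Poisson processes. -/

section Poisson

theorem extPoisson_singleton_zero {m : ℝ≥0∞} (hm : m ≠ ∞) :
    extPoisson m {0} = ENNReal.ofReal (Real.exp (-m.toReal)) := by
  rw [extPoisson, if_neg hm, Measure.map_apply (by fun_prop) (measurableSet_singleton _)]
  have : (fun n : ℕ => (n : ℕ∞)) ⁻¹' {0} = {0} := by ext; simp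
  rw [this, poissonMeasure_singleton]
  simp [ENNReal.coe_toNNReal_eq_toReal]

theorem extPoisson_singleton_top {m : ℝ≥0∞} (hm : m ≠ ∞) : extPoisson m {⊤} = 0 := by
  rw [extPoisson, if_neg hm, Measure.map_apply (by fun_prop) (measurableSet_singleton _)]
  have : (fun n : ℕ => (n : ℕ∞)) ⁻¹' {⊤} = ∅ := by ext; simp
  rw [this, measure_empty]

theorem pairwise_disjoint_pair {c d : Set ℝ} (hcd : Disjoint c d) :
    Pairwise fun i j => Disjoint ((![c, d] : Fin 2 → Set ℝ) i) ((![c, d] : Fin 2 → Set ℝ) j) := by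
  intro i j hij
  fin_cases i <;> fin_cases j <;> first | exact absurd rfl hij | exact hcd | exact hcd.symm

variable {Ω : Type*}

/-- The event that a random configuration has a point in `c` and none in `d`. -/
def hitVoid (N : Ω → Set ℝ) (c d : Set ℝ) : Set Ω :=
  {ω | (N ω ∩ c).Nonempty ∧ N ω ∩ d = ∅}

theorem hitVoid_eq_iInter (N : Ω → Set ℝ) (c d : Set ℝ) :
    hitVoid N c d = ⋂ i : Fin 2, {ω | (N ω ∩ (![c, d] : Fin 2 → Set ℝ) i).encard ∈
      (![{0}ᶜ, {0}] : Fin 2 → Set ℕ∞) i} := by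
  ext ω
  simp [hitVoid, Fin.forall_fin_two, nonempty_iff_ne_empty]

variable [MeasurableSpace Ω] {P : Measure Ω} {N : Ω → Set ℝ} {M : Measure ℝ}

namespace IsPoissonProcess

theorem measurableSet_count (hN : IsPoissonProcess N M P) {B : Set ℝ} (hB : MeasurableSet B)
    (u : Set ℕ∞) : MeasurableSet {ω | (N ω ∩ B).encard ∈ u} :=
  hN.measurable_count B hB (MeasurableSet.of_discrete)

theorem measurableSet_void (hN : IsPoissonProcess N M P) {B : Set ℝ} (hB : MeasurableSet B) :
    MeasurableSet {ω | N ω ∩ B = ∅} := by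
  simpa using hN.measurableSet_count hB {0}

theorem measurableSet_hitVoid (hN : IsPoissonProcess N M P) {c d : Set ℝ} (hc : MeasurableSet c)
    (hd : MeasurableSet d) : MeasurableSet (hitVoid N c d) := by
  rw [hitVoid_eq_iInter]
  refine MeasurableSet.iInter fun i => hN.measurableSet_count ?_ _
  fin_cases i <;> assumption

theorem measure_void (hN : IsPoissonProcess N M P) {B : Set ℝ} (hB : MeasurableSet B)
    (hfin : M B ≠ ∞) : P {ω | N ω ∩ B = ∅} = ENNReal.ofReal (Real.exp (-M.real B)) := by
  rw [measureReal_def, ← extPoisson_singleton_zero hfin, ← hN.map_count B hB,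
    Measure.map_apply (hN.measurable_count B hB) (measurableSet_singleton _)]
  congr 1
  ext ω
  simp

theorem ae_finite_inter (hN : IsPoissonProcess N M P) {B : Set ℝ} (hB : MeasurableSet B)
    (hfin : M B ≠ ∞) : ∀ᵐ ω ∂P, (N ω ∩ B).Finite := by
  rw [ae_iff, ← extPoisson_singleton_top hfin, ← hN.map_count B hB,
    Measure.map_apply (hN.measurable_count B hB) (measurableSet_singleton _)]
  congr 1
  ext ω
  simp [Set.encard_eq_top_iff]

theorem measure_iInter_count (hN : IsPoissonProcess N M P) {ι : Type*} [Fintype ι]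
    {B : ι → Set ℝ} (hB : ∀ i, MeasurableSet (B i)) (hd : Pairwise fun i j => Disjoint (B i) (B j))
    (u : ι → Set ℕ∞) :
    P (⋂ i, {ω | (N ω ∩ B i).encard ∈ u i}) = ∏ i, P {ω | (N ω ∩ B i).encard ∈ u i} := by
  let e := Fintype.equivFin ι
  have h : iIndepFun (fun i ω => (N ω ∩ B i).encard) P := by
    have := (hN.indep_count (Fintype.card ι) (fun k => B (e.symm k)) (fun k => hB _)
      (hd.comp_of_injective e.symm.injective)).precomp e.injective
    simpa using this
  exact h.meas_iInter fun i => ⟨u i, MeasurableSet.of_discrete, rfl⟩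

/-- Events depending on the counts in two finite families of disjoint sets are independent. -/
theorem measure_iInter_count_inter (hN : IsPoissonProcess N M P) {ι κ : Type*} [Fintype ι]
    [Fintype κ] {B : ι → Set ℝ} {C : κ → Set ℝ} (hB : ∀ i, MeasurableSet (B i))
    (hC : ∀ j, MeasurableSet (C j)) (hBd : Pairwise fun i j => Disjoint (B i) (B j))
    (hCd : Pairwise fun i j => Disjoint (C i) (C j)) (hBC : ∀ i j, Disjoint (B i) (C j))
    (u : ι → Set ℕ∞) (v : κ → Set ℕ∞) :
    P ((⋂ i, {ω | (N ω ∩ B i).encard ∈ u i}) ∩ ⋂ j, {ω | (N ω ∩ C j).encard ∈ v j}) =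
      P (⋂ i, {ω | (N ω ∩ B i).encard ∈ u i}) * P (⋂ j, {ω | (N ω ∩ C j).encard ∈ v j}) := by
  rw [hN.measure_iInter_count hB hBd, hN.measure_iInter_count hC hCd]
  -- Both families together form one disjoint family indexed by `ι ⊕ κ`, whose product formula
  -- splits.
  have h := hN.measure_iInter_count (B := Sum.elim B C) (by rintro (i | j) <;> simp [hB, hC])
    (by
      rintro (i | i) (j | j) hij
      · exact hBd fun h => hij (by rw [h])
      · exact hBC i j
      · exact (hBC j i).symm
      · exact hCd fun h => hij (by rw [h])) (Sum.elim u v)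
  rw [iInter_sum, Fintype.prod_sum_type] at h
  exact h

theorem measure_hitVoid (hN : IsPoissonProcess N M P) [IsProbabilityMeasure P] {c d : Set ℝ}
    (hc : MeasurableSet c) (hd : MeasurableSet d) (hcd : Disjoint c d) (hcfin : M c ≠ ∞)
    (hdfin : M d ≠ ∞) : P (hitVoid N c d) =
      ENNReal.ofReal ((1 - Real.exp (-M.real c)) * Real.exp (-M.real d)) := by
  have h := hN.measure_iInter_count (B := ![c, d]) (by
    intro i; fin_cases i <;> assumption) (pairwise_disjoint_pair hcd) ![{0}ᶜ, {0}]
  rw [← hitVoid_eq_iInter, Fin.prod_univ_two] at h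
  rw [h, ENNReal.ofReal_mul (by simp [measureReal_nonneg]), ← hN.measure_void hd hdfin]
  have hcompl : {ω | (N ω ∩ (![c, d] : Fin 2 → Set ℝ) 0).encard ∈
      (![{0}ᶜ, {0}] : Fin 2 → Set ℕ∞) 0} = {ω | N ω ∩ c = ∅}ᶜ := by
    ext ω; simp
  rw [hcompl, prob_compl_eq_one_sub (hN.measurableSet_void hc), hN.measure_void hc hcfin,
    ENNReal.ofReal_sub _ (Real.exp_nonneg _), ENNReal.ofReal_one]
  simp

theorem measure_iInter_count_inter_hitVoid (hN : IsPoissonProcess N M P) {ι : Type*} [Fintype ι]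
    {B : ι → Set ℝ} {c d : Set ℝ} (hB : ∀ i, MeasurableSet (B i))
    (hBd : Pairwise fun i j => Disjoint (B i) (B j)) (hc : MeasurableSet c) (hd : MeasurableSet d)
    (hcd : Disjoint c d) (hBc : ∀ i, Disjoint (B i) c) (hBd' : ∀ i, Disjoint (B i) d)
    (u : ι → Set ℕ∞) :
    P ((⋂ i, {ω | (N ω ∩ B i).encard ∈ u i}) ∩ hitVoid N c d) =
      P (⋂ i, {ω | (N ω ∩ B i).encard ∈ u i}) * P (hitVoid N c d) := by
  rw [hitVoid_eq_iInter]
  refine hN.measure_iInter_count_inter hB ?_ hBd (pairwise_disjoint_pair hcd) ?_ _ _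
  · intro i; fin_cases i <;> assumption
  · intro i j; fin_cases j
    · exact hBc i
    · exact hBd' i

end IsPoissonProcess

end Poisson

end GapProblem

namespace GapProblem

/-! ### The cumulative function and the partition into cells. -/

section Cumulative

variable {M : Measure ℝ}

/-- The cumulative function `t ↦ M (0, t]`. -/
noncomputable def cumul (M : Measure ℝ) (t : ℝ) : ℝ := ∫ _ in (0 : ℝ)..t, (1 : ℝ) ∂M

/-- The probability that `(t, t + ℓ)` contains no point of a Poisson process with intensity
measure `M`. -/
noncomputable def voidProb (M : Measure ℝ) (ℓ t : ℝ) : ℝ≥0∞ :=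
  ENNReal.ofReal (Real.exp (-M.real (Ioo t (t + ℓ))))

theorem measureReal_Ioc_eq_cumul_sub [IsLocallyFiniteMeasure M] {a b : ℝ} (hab : a ≤ b) :
    M.real (Ioc a b) = cumul M b - cumul M a := by
  rw [cumul, cumul, intervalIntegral.integral_interval_sub_left intervalIntegrable_const
    intervalIntegrable_const, intervalIntegral.integral_const']
  simp [hab]

theorem monotone_cumul [IsLocallyFiniteMeasure M] : Monotone (cumul M) := fun a b hab => by
  rw [← sub_nonneg, ← measureReal_Ioc_eq_cumul_sub hab]
  exact measureReal_nonneg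

theorem continuous_cumul [IsLocallyFiniteMeasure M] [NullSingletonClass M] : Continuous (cumul M) :=
  intervalIntegral.continuous_primitive (fun _ _ => intervalIntegrable_const) 0

theorem measureReal_Ioo_eq_cumul_sub [IsLocallyFiniteMeasure M] [NullSingletonClass M] {a b : ℝ}
    (hab : a ≤ b) : M.real (Ioo a b) = cumul M b - cumul M a := by
  rw [← measureReal_Ioc_eq_cumul_sub hab, measureReal_congr Ioo_ae_eq_Ioc]

theorem voidProb_eq [IsLocallyFiniteMeasure M] [NullSingletonClass M] {ℓ : ℝ} (hℓ : 0 < ℓ) (t : ℝ) :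
    voidProb M ℓ t = ENNReal.ofReal (Real.exp (-(cumul M (t + ℓ) - cumul M t))) := by
  rw [voidProb, measureReal_Ioo_eq_cumul_sub (by linarith)]

theorem measurable_voidProb [IsLocallyFiniteMeasure M] [NullSingletonClass M] {ℓ : ℝ} (hℓ : 0 < ℓ) :
    Measurable (voidProb M ℓ) := by
  have h := continuous_cumul (M := M)
  simp only [funext (voidProb_eq (M := M) hℓ)]
  fun_prop

theorem exists_cumul_ge [IsLocallyFiniteMeasure M] (hM : M (Ioi 0) = ∞) (y : ℝ) :
    ∃ t, y ≤ cumul M t := by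
  by_contra! h
  have hunion : (⋃ n : ℕ, Ioc (0 : ℝ) n) = Ioi 0 := by
    ext x
    simp only [mem_iUnion, mem_Ioc, mem_Ioi]
    exact ⟨fun ⟨_, hx, _⟩ => hx, fun hx => (exists_nat_ge x).imp fun _ hn => ⟨hx, hn⟩⟩
  have hmono : Monotone fun n : ℕ => Ioc (0 : ℝ) n := fun m n hmn =>
    Ioc_subset_Ioc_right (by exact_mod_cast hmn)
  rw [← hunion, hmono.measure_iUnion, iSup_eq_top] at hM
  obtain ⟨n, hn⟩ := hM (ENNReal.ofReal y) ENNReal.ofReal_lt_top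
  rw [← ofReal_measureReal (measure_Ioc_lt_top.ne), measureReal_Ioc_eq_cumul_sub (by positivity)]
    at hn
  have h0 : cumul M 0 = 0 := by simp [cumul]
  rw [h0, sub_zero] at hn
  exact absurd hn (not_lt.2 (ENNReal.ofReal_le_ofReal (h n).le))

/-- A partition of `(a, ∞)` whose cells, and their translates by `ℓ`, have mass at most one. -/
theorem exists_partition [IsLocallyFiniteMeasure M] [NullSingletonClass M] (hM : M (Ioi 0) = ∞) {ℓ : ℝ}
    (hℓ : 0 < ℓ) (a : ℝ) : ∃ t : ℕ → ℝ, Monotone t ∧ (∀ k, a ≤ t k) ∧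
      (⋃ k, Ioc (t k) (t (k + 1))) = Ioi a ∧
      (∀ k, cumul M (t (k + 1)) - cumul M (t k) ≤ 1) ∧
      ∀ k, cumul M (t (k + 1) + ℓ) - cumul M (t k + ℓ) ≤ 1 := by
  let g : ℝ → ℝ := fun t => cumul M t + cumul M (t + ℓ)
  have hF := continuous_cumul (M := M)
  have hg : Continuous g := by fun_prop
  have hmono : Monotone g := fun x y hxy =>
    add_le_add (monotone_cumul hxy) (monotone_cumul (by linarith))
  -- As `g` need not be injective, `x = a` for `k = 0` is imposed separately; the cells must start
  -- exactly at `a`.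
  have hex : ∀ k : ℕ, ∃ x, g x = g a + k ∧ (k = 0 → x = a) := by
    intro k
    rcases Nat.eq_zero_or_pos k with rfl | hk
    · exact ⟨a, by simp, fun _ => rfl⟩
    · obtain ⟨b, hb⟩ := exists_cumul_ge hM (g a + k - cumul M a)
      have hgb : g a + k ≤ g (max a b) := by
        have h1 : cumul M b ≤ cumul M (max a b) := monotone_cumul (le_max_right _ _)
        have h2 : cumul M a ≤ cumul M (max a b + ℓ) :=
          monotone_cumul ((le_max_left a b).trans (by linarith))
        simp only [g] at hb ⊢
        linarith
      obtain ⟨x, -, hx⟩ := intermediate_value_Icc (le_max_left a b) hg.continuousOn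
        (⟨by simp, hgb⟩ : g a + k ∈ Icc (g a) (g (max a b)))
      exact ⟨x, hx, fun h => absurd h hk.ne'⟩
  choose t ht ht0 using hex
  have htm : Monotone t := by
    refine monotone_nat_of_le_succ fun k => not_lt.1 fun h => ?_
    have := hmono h.le
    rw [ht, ht] at this
    push_cast at this
    linarith
  refine ⟨t, htm, fun k => (ht0 0 rfl).ge.trans (htm k.zero_le), ?_, fun k => ?_, fun k => ?_⟩
  · have hunb : ¬BddAbove (range t) := by
      rintro ⟨b, hb⟩
      obtain ⟨k, hk⟩ := exists_nat_gt (g b - g a)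
      have := hmono (hb ⟨k, rfl⟩)
      rw [ht] at this
      linarith
    simpa [ht0 0 rfl] using iUnion_Ioc_map_succ_eq_Ioi (fun k => htm bot_le) hunb
  · have h1 := ht k
    have h2 := ht (k + 1)
    have h3 : cumul M (t k + ℓ) ≤ cumul M (t (k + 1) + ℓ) :=
      monotone_cumul (by linarith [htm k.le_succ])
    push_cast at h2
    simp only [g] at h1 h2
    linarith
  · have h1 := ht k
    have h2 := ht (k + 1)
    have h3 : cumul M (t k) ≤ cumul M (t (k + 1)) := monotone_cumul (htm k.le_succ)
    push_cast at h2
    simp only [g] at h1 h2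
    linarith

theorem tsum_setLIntegral_partition {t : ℕ → ℝ} {a : ℝ} (ht : Monotone t)
    (hcov : (⋃ k, Ioc (t k) (t (k + 1))) = Ioi a) (f : ℝ → ℝ≥0∞) :
    ∑' k, ∫⁻ x in Ioc (t k) (t (k + 1)), f x ∂M = ∫⁻ x in Ioi a, f x ∂M := by
  rw [← hcov, lintegral_iUnion (fun _ => measurableSet_Ioc)]
  simpa using ht.pairwise_disjoint_on_Ioc_succ

theorem tendsto_setLIntegral_Ioi_zero {f : ℝ → ℝ≥0∞} (hf : ∫⁻ x in Ioi 0, f x ∂M ≠ ∞) {h : ℝ}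
    (hh : 0 < h) : Filter.Tendsto (fun m : ℕ => ∫⁻ x in Ioi (m * h), f x ∂M) Filter.atTop
      (nhds 0) := by
  set ν := (M.restrict (Ioi 0)).withDensity f with hν
  have hsub : ∀ m : ℕ, Ioi ((m : ℝ) * h) ⊆ Ioi 0 := fun m => Ioi_subset_Ioi (by positivity)
  have hval : ∀ m : ℕ, ν (Ioi (m * h)) = ∫⁻ x in Ioi (m * h), f x ∂M := fun m => by
    rw [hν, withDensity_apply _ measurableSet_Ioi, Measure.restrict_restrict measurableSet_Ioi,
      inter_eq_left.2 (hsub m)]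
  have hempty : (⋂ m : ℕ, Ioi ((m : ℝ) * h)) = ∅ := by
    refine eq_empty_of_forall_notMem fun x hx => ?_
    obtain ⟨m, hm⟩ := exists_nat_gt (x / h)
    rw [div_lt_iff₀ hh] at hm
    exact absurd (mem_iInter.1 hx m) (not_lt.2 hm.le)
  have hlim := tendsto_measure_iInter_atTop (μ := ν) (s := fun m : ℕ => Ioi ((m : ℝ) * h))
    (fun m => measurableSet_Ioi.nullMeasurableSet)
    (fun m n hmn => Ioi_subset_Ioi (by gcongr)) ⟨0, by
      rw [hval]
      simpa using hf⟩
  rw [hempty, measure_empty] at hlim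
  simpa only [Function.comp_def, hval] using hlim

end Cumulative

/-! ### Comparison of the integral over a cell with a probability. -/

section Cells

variable {Ω : Type*} [MeasurableSpace Ω] {P : Measure Ω} [IsProbabilityMeasure P] {N : Ω → Set ℝ}
  {M : Measure ℝ} [IsLocallyFiniteMeasure M] [NullSingletonClass M] {ℓ s s' : ℝ}

namespace IsPoissonProcess

/-- The event bounded here contains the event that some point of the cell `(s, s']` is followed by
a window of length `ℓ` without points. -/
theorem measure_hitVoid_le_setLIntegral (hN : IsPoissonProcess N M P) (hℓ : 0 < ℓ)
    (h1 : cumul M s' - cumul M s ≤ 1) (h2 : cumul M (s' + ℓ) - cumul M (s + ℓ) ≤ 1) :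
    P (hitVoid N (Ioc s s') (Ioo s' (s + ℓ))) ≤
      ENNReal.ofReal (Real.exp 2) * ∫⁻ x in Ioc s s', voidProb M ℓ x ∂M := by
  -- For a cell longer than `ℓ` the window is empty and the left side is nonpositive.
  have hd : cumul M (s + ℓ) - cumul M s' ≤ M.real (Ioo s' (s + ℓ)) := by
    rcases le_total s' (s + ℓ) with h | h
    · rw [measureReal_Ioo_eq_cumul_sub h]
    · have := monotone_cumul (M := M) h
      linarith [measureReal_nonneg (μ := M) (s := Ioo s' (s + ℓ))]
  have hdisj : Disjoint (Ioc s s') (Ioo s' (s + ℓ)) :=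
    Set.disjoint_left.2 fun x hx hx' => absurd hx.2 (not_le.2 hx'.1)
  rw [hN.measure_hitVoid measurableSet_Ioc measurableSet_Ioo hdisj measure_Ioc_lt_top.ne
    measure_Ioo_lt_top.ne, ← lintegral_const_mul _ (measurable_voidProb hℓ)]
  calc _ ≤ ENNReal.ofReal (M.real (Ioc s s') * Real.exp (-(cumul M (s + ℓ) - cumul M s'))) := by
        refine ENNReal.ofReal_le_ofReal (mul_le_mul ?_ ?_ (Real.exp_nonneg _) measureReal_nonneg)
        · linarith [Real.add_one_le_exp (-M.real (Ioc s s'))]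
        · exact Real.exp_le_exp.2 (by linarith)
    _ = ∫⁻ _ in Ioc s s', ENNReal.ofReal (Real.exp (-(cumul M (s + ℓ) - cumul M s'))) ∂M := by
        rw [setLIntegral_const, ENNReal.ofReal_mul measureReal_nonneg,
          ofReal_measureReal measure_Ioc_lt_top.ne, mul_comm]
    _ ≤ _ := by
        refine setLIntegral_mono ((measurable_voidProb hℓ).const_mul _) fun x hx => ?_
        rw [voidProb_eq hℓ, ← ENNReal.ofReal_mul (Real.exp_nonneg _), ← Real.exp_add]
        -- Moving from `x` to the cell's endpoints costs at most one in each of `F(x)` and `F(x +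
        -- ℓ)`, hence the factor `e²`.
        refine ENNReal.ofReal_le_ofReal (Real.exp_le_exp.2 ?_)
        have h3 : cumul M (x + ℓ) ≤ cumul M (s' + ℓ) := monotone_cumul (by linarith [hx.2])
        have h4 : cumul M s ≤ cumul M x := monotone_cumul hx.1.le
        linarith

/-- One factor `e` comes from the variation of the void probability on the cell, the other from `x ≤
e (1 - exp (-x))` for the cell mass `x ≤ 1`. The event on the right forces a gap after the last
point of the cell. -/
theorem setLIntegral_le_measure_hitVoid (hN : IsPoissonProcess N M P) (hℓ : 0 < ℓ) (hs : s ≤ s')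
    (h1 : cumul M s' - cumul M s ≤ 1) (h2 : cumul M (s' + ℓ) - cumul M (s + ℓ) ≤ 1) :
    ∫⁻ x in Ioc s s', voidProb M ℓ x ∂M ≤
      ENNReal.ofReal (Real.exp 2) * P (hitVoid N (Ioc s s') (Ioc s' (s' + ℓ))) := by
  have hdisj : Disjoint (Ioc s s') (Ioc s' (s' + ℓ)) :=
    Set.disjoint_left.2 fun x hx hx' => absurd hx.2 (not_le.2 hx'.1)
  rw [hN.measure_hitVoid measurableSet_Ioc measurableSet_Ioc hdisj measure_Ioc_lt_top.ne
    measure_Ioc_lt_top.ne, measureReal_Ioc_eq_cumul_sub (M := M) (by linarith : s' ≤ s' + ℓ)]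
  calc _ ≤ ∫⁻ _ in Ioc s s', ENNReal.ofReal (Real.exp (1 - (cumul M (s' + ℓ) - cumul M s'))) ∂M := by
        refine setLIntegral_mono measurable_const fun x hx => ?_
        rw [voidProb_eq hℓ]
        refine ENNReal.ofReal_le_ofReal (Real.exp_le_exp.2 ?_)
        have h3 : cumul M (s + ℓ) ≤ cumul M (x + ℓ) := monotone_cumul (by linarith [hx.1])
        have h4 : cumul M x ≤ cumul M s' := monotone_cumul hx.2
        linarith
    _ = ENNReal.ofReal (M.real (Ioc s s') * Real.exp (1 - (cumul M (s' + ℓ) - cumul M s'))) := by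
        rw [setLIntegral_const, ENNReal.ofReal_mul measureReal_nonneg,
          ofReal_measureReal measure_Ioc_lt_top.ne, mul_comm]
    _ ≤ _ := by
        rw [← ENNReal.ofReal_mul (Real.exp_nonneg _)]
        refine ENNReal.ofReal_le_ofReal ?_
        set x := M.real (Ioc s s') with hx
        have hx0 : 0 ≤ x := measureReal_nonneg
        have hx1 : x ≤ 1 := by rw [hx, measureReal_Ioc_eq_cumul_sub hs]; exact h1
        have key : x ≤ Real.exp 1 * (1 - Real.exp (-x)) := by
          have e1 : Real.exp 1 * (1 - Real.exp (-x)) = Real.exp (1 - x) * (Real.exp x - 1) := by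
            rw [mul_sub, mul_sub, ← Real.exp_add, ← Real.exp_add]
            ring_nf
          rw [e1]
          have e2 : 1 ≤ Real.exp (1 - x) := Real.one_le_exp (by linarith)
          have e3 : x ≤ Real.exp x - 1 := by linarith [Real.add_one_le_exp x]
          calc x = 1 * x := (one_mul x).symm
            _ ≤ _ := mul_le_mul e2 e3 hx0 (Real.exp_nonneg _)
        have e4 : Real.exp 2 = Real.exp 1 * Real.exp 1 := by rw [← Real.exp_add]; norm_num
        rw [sub_eq_add_neg 1 (_ - _), Real.exp_add, e4]
        have := mul_le_mul_of_nonneg_right key (mul_nonneg (Real.exp_nonneg 1)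
          (Real.exp_nonneg (-(cumul M (s' + ℓ) - cumul M s'))))
        linarith

end IsPoissonProcess

end Cells

end GapProblem

namespace GapProblem

/-! ### Almost sure existence of a gap. -/

namespace IsPoissonProcess

variable {Ω : Type*} [MeasurableSpace Ω] {P : Measure Ω} {N : Ω → Set ℝ} {M : Measure ℝ} {ℓ : ℝ}

theorem ae_locallyFinite [IsLocallyFiniteMeasure M] (hN : IsPoissonProcess N M P) :
    ∀ᵐ ω ∂P, ∀ b : ℝ, (N ω ∩ Iic b).Finite := by
  have h : ∀ᵐ ω ∂P, ∀ n : ℕ, (N ω ∩ Ioc (0 : ℝ) n).Finite :=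
    ae_all_iff.2 fun n => hN.ae_finite_inter measurableSet_Ioc measure_Ioc_lt_top.ne
  filter_upwards [h] with ω hω b
  obtain ⟨n, hn⟩ := exists_nat_ge b
  exact (hω n).subset fun x hx => ⟨hx.1, hN.subset_Ioi ω hx.1, hx.2.trans hn⟩

theorem ae_firstGap_lt_top_of_measure_lt_top (hN : IsPoissonProcess N M P) (hM : M (Ioi 0) < ∞) :
    ∀ᵐ ω ∂P, firstGap ℓ (N ω) < ∞ := by
  filter_upwards [hN.ae_finite_inter measurableSet_Ioi hM.ne] with ω hω
  rw [inter_eq_left.2 (hN.subset_Ioi ω)] at hω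
  obtain ⟨s, hs, hmax⟩ := Set.exists_max_image (insert 0 (N ω)) id (hω.insert 0) ⟨0, by simp⟩
  refine firstGap_lt_top (hN.subset_Ioi ω) (fun b => hω.subset inter_subset_left) hs
    (eq_empty_of_forall_notMem fun x hx => ?_)
  exact absurd (hmax x (mem_insert_of_mem _ hx.1)) (not_le.2 hx.2.1)

variable [IsProbabilityMeasure P]

/-- On the first event the second cell can be hit only beyond `r = max t (s' + ℓ)`. Shrinking that
cell to `(r, t']` makes the two events independent, and the shrunken event is contained in the
original one. -/
theorem measureReal_hitVoid_inter_le (hN : IsPoissonProcess N M P) {s s' t t' : ℝ}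
    (hst : s' ≤ t) (ht : t ≤ t') (hℓ : 0 < ℓ) :
    P.real (hitVoid N (Ioc s s') (Ioc s' (s' + ℓ)) ∩ hitVoid N (Ioc t t') (Ioc t' (t' + ℓ))) ≤
      P.real (hitVoid N (Ioc s s') (Ioc s' (s' + ℓ))) *
        P.real (hitVoid N (Ioc t t') (Ioc t' (t' + ℓ))) := by
  set r := max t (s' + ℓ) with hr
  have htr : t ≤ r := le_max_left _ _
  have hsr : s' + ℓ ≤ r := le_max_right _ _
  have hsub : hitVoid N (Ioc s s') (Ioc s' (s' + ℓ)) ∩ hitVoid N (Ioc t t') (Ioc t' (t' + ℓ)) ⊆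
      hitVoid N (Ioc s s') (Ioc s' (s' + ℓ)) ∩ hitVoid N (Ioc r t') (Ioc t' (t' + ℓ)) := by
    rintro ω ⟨h1, ⟨x, hx, htx, hxt⟩, h2⟩
    refine ⟨h1, ⟨x, hx, max_lt htx (not_le.1 fun h => ?_), hxt⟩, h2⟩
    exact eq_empty_iff_forall_notMem.1 h1.2 x ⟨hx, hst.trans_lt htx, h⟩
  refine (measureReal_mono hsub).trans ?_
  rcases le_total t' r with h | h
  · have : hitVoid N (Ioc r t') (Ioc t' (t' + ℓ)) = ∅ := by
      simp [hitVoid, Ioc_eq_empty_of_le h]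
    rw [this, inter_empty, measureReal_empty]
    positivity
  · have hdisj : ∀ {a b c d : ℝ}, b ≤ c → Disjoint (Ioc a b) (Ioc c d) := fun h =>
      Set.disjoint_left.2 fun x hx hx' => absurd (hx.2.trans h) (not_le.2 hx'.1)
    have hind := hN.measure_iInter_count_inter_hitVoid
      (B := ![Ioc s s', Ioc s' (s' + ℓ)]) (c := Ioc r t') (d := Ioc t' (t' + ℓ))
      (by intro i; fin_cases i <;> exact measurableSet_Ioc)
      (pairwise_disjoint_pair (hdisj le_rfl)) measurableSet_Ioc measurableSet_Ioc (hdisj le_rfl)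
      (by intro i; fin_cases i <;> exact hdisj (by linarith))
      (by intro i; fin_cases i <;> exact hdisj (by linarith)) ![{0}ᶜ, {0}]
    rw [← hitVoid_eq_iInter] at hind
    rw [measureReal_def, hind, ENNReal.toReal_mul]
    refine mul_le_mul_of_nonneg_left (measureReal_mono ?_) measureReal_nonneg
    rintro ω ⟨⟨x, hx, hrx, hxt⟩, h2⟩
    exact ⟨⟨x, hx, htr.trans_lt hrx, hxt⟩, h2⟩

theorem ae_firstGap_lt_top_of_lintegral_eq_top [IsLocallyFiniteMeasure M]
    [NullSingletonClass M] (hN : IsPoissonProcess N M P) (hℓ : 0 < ℓ)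
    (hM : M (Ioi 0) = ∞) (hI : ∫⁻ t in Ioi 0, voidProb M ℓ t ∂M = ∞) :
    ∀ᵐ ω ∂P, firstGap ℓ (N ω) < ∞ := by
  obtain ⟨t, htm, -, hcov, h1, h2⟩ := exists_partition hM hℓ 0
  have hex := ae_exists_mem_of_tsum_eq_top (P := P)
    (E := fun k => hitVoid N (Ioc (t k) (t (k + 1))) (Ioc (t (k + 1)) (t (k + 1) + ℓ)))
    (fun k => hN.measurableSet_hitVoid measurableSet_Ioc measurableSet_Ioc)
    (fun j k hjk => hN.measureReal_hitVoid_inter_le (htm hjk) (htm k.le_succ) hℓ)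
    (by
      rw [← tsum_setLIntegral_partition htm hcov] at hI
      have hle := ENNReal.tsum_le_tsum fun k =>
        hN.setLIntegral_le_measure_hitVoid hℓ (htm k.le_succ) (h1 k) (h2 k)
      rw [hI, ENNReal.tsum_mul_left, top_le_iff] at hle
      exact (ENNReal.mul_eq_top.1 hle).elim (fun h => h.2) fun h => absurd h.1 ENNReal.ofReal_ne_top)
  filter_upwards [hex, hN.ae_locallyFinite] with ω ⟨k, hk⟩ hfin
  obtain ⟨s, hs, hgap⟩ := exists_empty_window hfin hk.1 hk.2
  exact firstGap_lt_top (hN.subset_Ioi ω) hfin (mem_insert_of_mem _ hs) hgap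

end IsPoissonProcess

/-! ### Positive probability of no gap. -/

section FiniteIntegral

variable {M : Measure ℝ} [IsLocallyFiniteMeasure M] [NullSingletonClass M]

/-- If the integral of the void probabilities is finite, arbitrarily late cells of length `h` have
mass at least one. -/
theorem frequently_one_le_measureReal (hM : M (Ioi 0) = ∞) {h : ℝ} (hh : 0 < h)
    (hI : ∫⁻ t in Ioi 0, voidProb M (2 * h) t ∂M ≠ ∞) :
    ∃ᶠ m : ℕ in Filter.atTop, 1 ≤ M.real (Ioo (m * h) ((m + 1) * h)) := by
  intro hev
  obtain ⟨m₀, hm₀⟩ := Filter.eventually_atTop.1 hev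
  have hstep : ∀ m : ℕ, m₀ ≤ m → cumul M ((m + 1) * h) - cumul M (m * h) ≤ 1 := fun m hm => by
    rw [← measureReal_Ioo_eq_cumul_sub (by nlinarith)]
    exact (not_le.1 (hm₀ m hm)).le
  -- A window of length `2 h` is covered by three consecutive cells, each of mass at most one.
  have hlow : ∀ t ∈ Ioi ((m₀ : ℝ) * h), ENNReal.ofReal (Real.exp (-3)) ≤ voidProb M (2 * h) t := by
    intro t ht
    have ht0 : 0 ≤ t / h := div_nonneg (le_trans (by positivity) (le_of_lt ht)) hh.le
    set m := ⌊t / h⌋₊ with hm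
    have hm0 : m₀ ≤ m := Nat.le_floor ((le_div_iff₀ hh).2 (le_of_lt ht))
    have hmt : (m : ℝ) * h ≤ t := (le_div_iff₀ hh).1 (Nat.floor_le ht0)
    have htm : t < (m + 1) * h := (div_lt_iff₀ hh).1 (Nat.lt_floor_add_one _)
    rw [voidProb_eq (by positivity)]
    refine ENNReal.ofReal_le_ofReal (Real.exp_le_exp.2 ?_)
    have s0 := hstep m hm0
    have s1 := hstep (m + 1) (by omega)
    have s2 := hstep (m + 2) (by omega)
    push_cast at s1 s2
    have e1 : ((m : ℝ) + 1 + 1) = m + 2 := by ring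
    have e2 : ((m : ℝ) + 2 + 1) = m + 3 := by ring
    rw [e1] at s1
    rw [e2] at s2
    have c1 : cumul M (t + 2 * h) ≤ cumul M ((m + 3) * h) := monotone_cumul (by linarith)
    have c2 : cumul M (m * h) ≤ cumul M t := monotone_cumul hmt
    linarith
  have htail : M (Ioi ((m₀ : ℝ) * h)) = ∞ := by
    have hsub : Ioi (0 : ℝ) ⊆ Ioc 0 (m₀ * h) ∪ Ioi (m₀ * h) := fun x hx =>
      (le_or_gt x (m₀ * h)).imp (fun h => ⟨hx, h⟩) fun h => h
    have hle := (measure_mono hsub).trans (measure_union_le (μ := M) _ _)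
    rw [hM, top_le_iff, ENNReal.add_eq_top] at hle
    exact hle.resolve_left measure_Ioc_lt_top.ne
  refine hI (top_le_iff.1 ?_)
  calc ∞ = ∫⁻ _ in Ioi ((m₀ : ℝ) * h), ENNReal.ofReal (Real.exp (-3)) ∂M := by
        rw [setLIntegral_const, htail, ENNReal.mul_top]
        simp [Real.exp_pos]
    _ ≤ ∫⁻ t in Ioi ((m₀ : ℝ) * h), voidProb M (2 * h) t ∂M :=
        setLIntegral_mono (measurable_voidProb (by positivity)) hlow
    _ ≤ _ := lintegral_mono_set (Ioi_subset_Ioi (by positivity))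

end FiniteIntegral

/-- A configuration that meets the cells of length `h` up to `(m + 1) h`, and in which the points
beyond `m h` are followed closely, has points in all windows of length `2 h` after `0` and after its
points. -/
theorem inter_window_nonempty {S : Set ℝ} (hpos : S ⊆ Ioi 0) {h : ℝ} (hh : 0 < h) {m : ℕ}
    (hcells : ∀ i ≤ m, (S ∩ Ioo ((i : ℝ) * h) ((i + 1) * h)).Nonempty) {t : ℕ → ℝ}
    (hcov : (⋃ k, Ioc (t k) (t (k + 1))) = Ioi (m * h))
    (hbad : ∀ k, (S ∩ Ioc (t k) (t (k + 1))).Nonempty →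
      (S ∩ Ioo (t (k + 1)) (t k + 2 * h)).Nonempty) {s : ℝ} (hs : s ∈ insert 0 S) :
    (S ∩ Ioo s (s + 2 * h)).Nonempty := by
  have hs0 : 0 ≤ s := by
    rcases hs with rfl | hs
    · exact le_rfl
    · exact (hpos hs).le
  rcases lt_trichotomy s (m * h) with hsm | rfl | hsm
  · set i := ⌊s / h⌋₊ with hi
    have his : (i : ℝ) * h ≤ s := (le_div_iff₀ hh).1 (Nat.floor_le (by positivity))
    have hsi : s < (i + 1) * h := (div_lt_iff₀ hh).1 (Nat.lt_floor_add_one _)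
    have him : i < m := by
      have := lt_of_mul_lt_mul_right (his.trans_lt hsm) hh.le
      exact_mod_cast this
    -- With `s` in `[i h, (i + 1) h)`, the whole next cell lies in `(s, s + 2 h)`.
    obtain ⟨x, hx, hix, hxi⟩ := hcells (i + 1) him
    push_cast at hix hxi
    exact ⟨x, hx, by linarith, by linarith⟩
  · obtain ⟨x, hx, hix, hxi⟩ := hcells m le_rfl
    exact ⟨x, hx, hix, by linarith⟩
  · have hsS : s ∈ S := by
      rcases hs with rfl | hs
      · exact absurd hsm (not_lt.2 (by positivity))
      · exact hs
    have hmem : s ∈ ⋃ k, Ioc (t k) (t (k + 1)) := hcov ▸ hsm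
    obtain ⟨k, hk⟩ := mem_iUnion.1 hmem
    obtain ⟨x, hx, hkx, hxk⟩ := hbad k ⟨s, hsS, hk⟩
    exact ⟨x, hx, hk.2.trans_lt hkx, by linarith [hk.1]⟩

namespace IsPoissonProcess

variable {Ω : Type*} [MeasurableSpace Ω] {P : Measure Ω} [IsProbabilityMeasure P] {N : Ω → Set ℝ}
  {M : Measure ℝ} {ℓ : ℝ}

theorem measure_iInter_nonempty_ne_zero (hN : IsPoissonProcess N M P) {ι : Type*} [Fintype ι]
    {B : ι → Set ℝ} (hB : ∀ i, MeasurableSet (B i)) (hd : Pairwise fun i j => Disjoint (B i) (B j))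
    (hpos : ∀ i, M (B i) ≠ 0) (hfin : ∀ i, M (B i) ≠ ∞) :
    P (⋂ i, {ω | (N ω ∩ B i).encard ∈ ({0}ᶜ : Set ℕ∞)}) ≠ 0 := by
  rw [hN.measure_iInter_count hB hd, Finset.prod_ne_zero_iff]
  intro i _
  have hcompl : {ω | (N ω ∩ B i).encard ∈ ({0}ᶜ : Set ℕ∞)} = {ω | N ω ∩ B i = ∅}ᶜ := by
    ext ω; simp
  rw [hcompl, prob_compl_eq_one_sub (hN.measurableSet_void (hB i)), hN.measure_void (hB i) (hfin i)]
  refine (tsub_pos_of_lt ?_).ne'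
  rw [ENNReal.ofReal_lt_one, Real.exp_lt_one_iff, neg_lt_zero]
  exact ENNReal.toReal_pos (hpos i) (hfin i)

theorem measure_firstGap_eq_top_pos [IsLocallyFiniteMeasure M] [NullSingletonClass M]
    (hN : IsPoissonProcess N M P) (hℓ : 0 < ℓ)
    (hpos : ∀ a b : ℝ, 0 ≤ a → a < b → M (Ioo a b) ≠ 0) (hM : M (Ioi 0) = ∞)
    (hI : ∫⁻ t in Ioi 0, voidProb M ℓ t ∂M ≠ ∞) : 0 < P {ω | firstGap ℓ (N ω) = ∞} := by
  obtain ⟨h, rfl⟩ : ∃ h, ℓ = 2 * h := ⟨ℓ / 2, by ring⟩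
  have hh : 0 < h := by linarith
  have hsmall : ∀ᶠ m : ℕ in Filter.atTop, ENNReal.ofReal (Real.exp 2) *
      ∫⁻ x in Ioi (m * h), voidProb M (2 * h) x ∂M < 1 / 2 := by
    have := ENNReal.Tendsto.const_mul (a := ENNReal.ofReal (Real.exp 2))
      (tendsto_setLIntegral_Ioi_zero hI hh) (Or.inr ENNReal.ofReal_ne_top)
    rw [mul_zero] at this
    exact this.eventually_lt_const (by simp)
  obtain ⟨m, hm1, hm2⟩ := ((frequently_one_le_measureReal hM hh hI).and_eventually hsmall).exists
  obtain ⟨t, htm, htge, hcov, h1, h2⟩ := exists_partition hM hℓ (m * h)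
  let cell : ℕ → Set ℝ := fun i => Ioo ((i : ℝ) * h) ((i + 1) * h)
  have hcell : ∀ i j : ℕ, i < j → Disjoint (cell i) (cell j) := by
    intro i j hij
    refine Set.disjoint_left.2 fun x hx hx' => ?_
    have hij' : (i : ℝ) + 1 ≤ j := by exact_mod_cast hij
    have := mul_le_mul_of_nonneg_right hij' hh.le
    linarith [hx.2, hx'.1]
  have hcellm : ∀ i : Fin m, ∀ x ∈ cell i, x < m * h := by
    intro i x hx
    have hij' : (i : ℝ) + 1 ≤ m := by exact_mod_cast i.2
    exact hx.2.trans_le (mul_le_mul_of_nonneg_right hij' hh.le)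
  set A := ⋂ i : Fin m, {ω | (N ω ∩ cell i).encard ∈ ({0}ᶜ : Set ℕ∞)} with hA
  set V := {ω | N ω ∩ cell m = ∅} with hV
  let bad : ℕ → Set Ω := fun k =>
    hitVoid N (Ioc (t k) (t (k + 1))) (Ioo (t (k + 1)) (t k + 2 * h))
  have hcellmeas : ∀ i : Fin m, MeasurableSet (cell i) := fun i => measurableSet_Ioo
  have hcelld : Pairwise fun i j : Fin m => Disjoint (cell i) (cell j) := fun i j hij => by
    rcases lt_or_gt_of_ne hij with h | h
    · exact hcell i j h
    · exact (hcell j i h).symm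
  have hA0 : P A ≠ 0 := hN.measure_iInter_nonempty_ne_zero hcellmeas hcelld
    (fun i => hpos _ _ (by positivity) (by nlinarith)) fun i => measure_Ioo_lt_top.ne
  have hAV : P (A ∩ V) ≤ P A * (1 / 2) := by
    have hVi : V = ⋂ _ : Unit, {ω | (N ω ∩ cell m).encard ∈ ({0} : Set ℕ∞)} := by
      ext ω; simp [hV]
    have hVm : P V ≤ 1 / 2 := by
      rw [hN.measure_void measurableSet_Ioo measure_Ioo_lt_top.ne, one_div,
        ← ENNReal.ofReal_ofNat, ← ENNReal.ofReal_inv_of_pos (by norm_num)]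
      refine ENNReal.ofReal_le_ofReal ?_
      rw [Real.exp_neg]
      refine inv_anti₀ (by norm_num) ?_
      linarith [Real.add_one_le_exp (M.real (cell m))]
    have hind := hN.measure_iInter_count_inter (C := fun _ : Unit => cell m) hcellmeas
      (fun _ => measurableSet_Ioo) hcelld (fun i j hij => absurd (Subsingleton.elim i j) hij)
      (fun i _ => hcell i m i.2) (fun _ => {0}ᶜ) (fun _ => {0})
    rw [← hVi] at hind
    rw [hind]
    exact mul_le_mul_right hVm _
  -- The events `bad k` concern only points beyond `m h`, so they are independent of `A`. They may
  -- depend on `V`, which the union bound tolerates.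
  have hAbad : ∑' k, P (A ∩ bad k) < P A * (1 / 2) := by
    have hind : ∀ k, P (A ∩ bad k) = P A * P (bad k) := fun k =>
      hN.measure_iInter_count_inter_hitVoid hcellmeas hcelld measurableSet_Ioc measurableSet_Ioo
        (Set.disjoint_left.2 fun x hx hx' => absurd hx.2 (not_le.2 hx'.1))
        (fun i => Set.disjoint_left.2 fun x hx hx' =>
          absurd ((hcellm i x hx).trans_le (htge k)) (not_lt.2 hx'.1.le))
        (fun i => Set.disjoint_left.2 fun x hx hx' =>
          absurd ((hcellm i x hx).trans_le (htge (k + 1))) (not_lt.2 hx'.1.le)) _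
    simp only [hind, ENNReal.tsum_mul_left]
    refine (ENNReal.mul_lt_mul_iff_right hA0 (measure_ne_top _ _)).2 (lt_of_le_of_lt ?_ hm2)
    rw [← tsum_setLIntegral_partition htm hcov, ← ENNReal.tsum_mul_left]
    exact ENNReal.tsum_le_tsum fun k => hN.measure_hitVoid_le_setLIntegral hℓ (h1 k) (h2 k)
  rw [pos_iff_ne_zero]
  intro hzero
  have hgood : P (A \ (V ∪ ⋃ k, bad k)) = 0 := by
    refine measure_mono_null_ae ?_ hzero
    filter_upwards [hN.ae_locallyFinite] with ω hfin hω
    obtain ⟨hωA, hωb⟩ := hω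
    have hωV : ω ∉ V := fun h => hωb (Or.inl h)
    refine firstGap_eq_top (hN.subset_Ioi ω) hfin hℓ fun s hs =>
      inter_window_nonempty (hN.subset_Ioi ω) hh (m := m) (fun i hi => ?_) hcov (fun k hk => ?_) hs
    · rcases hi.lt_or_eq with hlt | rfl
      · simpa [nonempty_iff_ne_empty] using mem_iInter.1 hωA ⟨i, hlt⟩
      · exact nonempty_iff_ne_empty.2 hωV
    · refine nonempty_iff_ne_empty.2 fun he => hωb (Or.inr (mem_iUnion.2 ⟨k, hk, he⟩))
  have hcover : A ⊆ (A \ (V ∪ ⋃ k, bad k)) ∪ ((A ∩ V) ∪ ⋃ k, A ∩ bad k) := by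
    rw [← inter_iUnion, ← inter_union_distrib_left, sdiff_union_inter]
  have hle : P A ≤ P A * (1 / 2) + ∑' k, P (A ∩ bad k) := by
    refine (measure_mono hcover).trans ((measure_union_le _ _).trans ?_)
    rw [hgood, zero_add]
    exact (measure_union_le _ _).trans (add_le_add hAV (measure_iUnion_le _))
  have hlt : P A < P A := by
    refine hle.trans_lt ((ENNReal.add_lt_add_left (by finiteness) hAbad).trans_eq ?_)
    rw [← mul_add, ENNReal.add_halves, mul_one]
  exact lt_irrefl _ hlt

end IsPoissonProcess

/-! ### Transfer to the measure with density `μ`. -/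

section Intensity

variable {μ : ℝ → ℝ}

theorem isLocallyFiniteMeasure_intensity (hfin : ∀ t : ℝ, intensity μ (Ioo 0 t) < ∞) :
    IsLocallyFiniteMeasure (intensity μ) := by
  refine ⟨fun x => ⟨Iio (x + 1), Iio_mem_nhds (by linarith), ?_⟩⟩
  have hnull : intensity μ (Iic 0) = 0 := by
    refine withDensity_absolutelyContinuous _ _ ?_
    rw [Measure.restrict_apply measurableSet_Iic, Iic_inter_Ioi, Ioc_self, measure_empty]
  have hsub : Iio (x + 1) ⊆ Iic 0 ∪ Ioo 0 (x + 1) := fun y hy =>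
    (le_or_gt y 0).imp id fun h => ⟨h, hy⟩
  refine (measure_mono hsub).trans_lt ((measure_union_le _ _).trans_lt ?_)
  rw [hnull, zero_add]
  exact hfin _

/-- An almost everywhere positive density makes Lebesgue measure on `(0, ∞)` absolutely continuous
with respect to `intensity μ`. -/
theorem intensity_Ioo_ne_zero (hmeas : AEMeasurable μ (volume.restrict (Ioi (0 : ℝ))))
    (hpos : ∀ᵐ t ∂(volume.restrict (Ioi (0 : ℝ))), 0 < μ t) {a b : ℝ} (ha : 0 ≤ a) (hab : a < b) :
    intensity μ (Ioo a b) ≠ 0 := by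
  intro hzero
  have h := withDensity_absolutelyContinuous' hmeas.ennreal_ofReal
    (hpos.mono fun t ht => by simpa using ht) hzero
  rw [Measure.restrict_apply measurableSet_Ioo,
    inter_eq_left.2 (Ioo_subset_Ioi_self.trans (Ioi_subset_Ioi ha)), Real.volume_Ioo] at h
  simp at h
  linarith

theorem gapIntegral_eq_lintegral_voidProb
    (hmeas : AEMeasurable μ (volume.restrict (Ioi (0 : ℝ))))
    [IsLocallyFiniteMeasure (intensity μ)] {ℓ : ℝ} (hℓ : 0 < ℓ) :
    gapIntegral μ ℓ = ∫⁻ t in Ioi 0, voidProb (intensity μ) ℓ t ∂(intensity μ) := by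
  have : NullSingletonClass (intensity μ) := by unfold intensity; infer_instance
  have hv := measurable_voidProb (M := intensity μ) hℓ
  have hrestrict : (intensity μ).restrict (Ioi 0) = intensity μ := by
    rw [intensity, restrict_withDensity measurableSet_Ioi,
      Measure.restrict_restrict measurableSet_Ioi, inter_self]
  rw [hrestrict]
  -- The integrand also mentions `intensity μ`; naming it confines the unfolding below to the
  -- integrating measure.
  generalize hf : voidProb (intensity μ) ℓ = f at hv ⊢
  rw [intensity, lintegral_withDensity_eq_lintegral_mul₀ hmeas.ennreal_ofReal hv.aemeasurable,
    gapIntegral]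
  refine lintegral_congr fun t => ?_
  rw [ENNReal.ofReal_mul (Real.exp_nonneg _), Pi.mul_apply, mul_comm, ← hf]
  rfl

end Intensity

end GapProblem

theorem mainTheorem1 {Ω : Type*} [MeasurableSpace Ω] (P : Measure Ω) [IsProbabilityMeasure P]
    (μ : ℝ → ℝ) (hμ_meas : AEMeasurable μ (volume.restrict (Ioi (0 : ℝ))))
    (hμ_pos : ∀ᵐ t ∂(volume.restrict (Ioi (0 : ℝ))), 0 < μ t)
    (hμ_fin : ∀ t : ℝ, GapProblem.intensity μ (Ioo 0 t) < ∞)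
    (ℓ : ℝ) (hℓ : 0 < ℓ)
    (N : Ω → Set ℝ) (hN : GapProblem.IsPoissonProcess N (GapProblem.intensity μ) P) :
    (GapProblem.intensity μ (Ioi 0) < ∞ →
      ∀ᵐ ω ∂P, GapProblem.firstGap ℓ (N ω) < ∞) ∧
    (GapProblem.intensity μ (Ioi 0) = ∞ →
      (GapProblem.gapIntegral μ ℓ = ∞ →
        ∀ᵐ ω ∂P, GapProblem.firstGap ℓ (N ω) < ∞) ∧
      (GapProblem.gapIntegral μ ℓ < ∞ →
        0 < P {ω | GapProblem.firstGap ℓ (N ω) = ∞})) := by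
  have := GapProblem.isLocallyFiniteMeasure_intensity hμ_fin
  have : NullSingletonClass (GapProblem.intensity μ) := by
    unfold GapProblem.intensity; infer_instance
  rw [GapProblem.gapIntegral_eq_lintegral_voidProb hμ_meas hℓ]
  refine ⟨hN.ae_firstGap_lt_top_of_measure_lt_top, fun hM =>
    ⟨hN.ae_firstGap_lt_top_of_lintegral_eq_top hℓ hM, fun hI => ?_⟩⟩
  exact hN.measure_firstGap_eq_top_pos hℓ
    (fun a b ha hab => GapProblem.intensity_Ioo_ne_zero hμ_meas hμ_pos ha hab) hM hI.ne
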